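/- A partial order $\mathbf P$ is called the generic partial order if it is countable, every countable partial order embeds into it, and it is homogeneous (every isomorphism between two finite suborders extends to an automorphism); it is unique up to isomorphism. Let $\Sigma=\{\mathrm L,\mathrm X,\mathrm R\}$ be ordered by $\mathrm L<\mathrm X<\mathrm R$, let $\Sigma^*$ be the set of finite words over $\Sigma$ (characters indexed from $0$), let $\le_{\rm lex}$ be the lexicographic order of $\Sigma^*$ and let $|w|$ be the length of $w$. Write $w\prec w'$ if there is $0\le i<\min(|w|,|w'|)$ with $(w_i,w'_i)=(\mathrm L,\mathrm R)$ and $w_j\le w'_j$ for all $0\le j<i$; then $\preceq$ ($w\prec w'$ or $w=w'$) is a partial order of $\Sigma^*$. Write $w\perp w'$ if $w_i<w'_i$ and $w'_j<w_j$ for some $0\le i,j<\min(|w|,|w'|)$. Two words $w,w'$ are related if $w\preceq w'$, $w'\preceq w$ or $w\perp w'$, and unrelated otherwise. For $S\subseteq\Sigma^*$ let $\overline S$ be the set of all initial segments of words of $S$ and $S_i=\{w\in S:|w|=i\}$. A leaf of $S$ is a word $w\in S$ that is not a proper initial segment of a word of $S$. Write $w^\frown c$ for the word $w$ followed by the character $c$,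 and $A^\frown c=\{w^\frown c:w\in A\}$. A set $S\subseteq\Sigma^*$ is a poset-type if $S=\overline S$ and, for every $i\geq 0$ such that $i<|w|$ for some $w\in S$, precisely one of the following four conditions holds. 1. (Leaf) There is $w\in S_i$ related to every $u\in S_i\setminus\{w\}$ such that $S_{i+1}=(S_i\setminus\{w\})^\frown\mathrm X$. 2. (Branching) There is $w\in S_i$ such that $S_{i+1}=\{z\in S_i: z<_{\rm lex}w\}^\frown\mathrm X\cup\{w^\frown\mathrm X,w^\frown\mathrm R\}\cup\{z\in S_i:w<_{\rm lex}z\}^\frown\mathrm R$. 3. (New $\perp$) There are unrelated words $v<_{\rm lex}w$ in $S_i$ such that $$\begin{aligned}S_{i+1}={}&\{z\in S_i:z<_{\rm lex}v\}^\frown\mathrm X\cup\{v^\frown\mathrm R\}\cup\{z\in S_i:v<_{\rm lex}z<_{\rm lex}w,\ z\perp v\}^\frown\mathrm X\\&\cup\{z\in S_i:v<_{\rm lex}z<_{\rm lex}w,\ z\not\perp v\}^\frown\mathrm R\cup\{w^\frown\mathrm X\}\cup\{z\in S_i:w<_{\rm lex}z\}^\frown\mathrm R,\end{aligned}$$ and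 every $u\in S_i$ with $v<_{\rm lex}u<_{\rm lex}w$ satisfies $u\perp v$ or $u\perp w$. 4. (New $\preceq$) There are unrelated words $v<_{\rm lex}w$ in $S_i$ such that $$\begin{aligned}S_{i+1}={}&\{z\in S_i:z<_{\rm lex}v,\ z\perp v\}^\frown\mathrm X\cup\{z\in S_i:z<_{\rm lex}v,\ z\not\perp v\}^\frown\mathrm L\cup\{v^\frown\mathrm L\}\\&\cup\{z\in S_i:v<_{\rm lex}z<_{\rm lex}w\}^\frown\mathrm X\cup\{w^\frown\mathrm R\}\\&\cup\{z\in S_i:w<_{\rm lex}z,\ w\perp z\}^\frown\mathrm X\cup\{z\in S_i:w<_{\rm lex}z,\ w\not\perp z\}^\frown\mathrm R,\end{aligned}$$ every $u\in S_i$ with $u<_{\rm lex}v$ satisfies $u\preceq w$ or $u\perp v$, and every $u\in S_i$ with $w<_{\rm lex}u$ satisfies $v\preceq u$ or $w\perp u$. **Theorem.** Let $\mathbf P$ be the generic partial order. There is an embedding $\psi\colon\mathbf P\to(\Sigma^*,\preceq)$ (that is, $\psi$ is injective and $a\le_{\mathbf P} b\iff\psi(a)\preceq\psi(b)$) such that $\overline{\psi[\mathbf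 P]}$ is a poset-type and $\psi(p)$ is a leaf of $\overline{\psi[\mathbf P]}$ for every $p\in\mathbf P$. -/

import Mathlib

/-- The generic partial order: a countable homogeneous partial order into which every countable
partial order embeds (it exists and is unique up to isomorphism). -/
structure IsGenericPartialOrder (P : Type*) [PartialOrder P] : Prop where
  countable : Countable P
  /-- Every isomorphism between finite suborders extends to an automorphism. -/
  homogeneous : ∀ (A B : Finset P) (e : A ≃o B), ∃ g : P ≃o P, ∀ a : A, g a = e a
  /-- Every countable partial order has an embedding into `P`. -/
  universal : ∀ (Q : Type) [PartialOrder Q] [Countable Q], Nonempty (Q ↪o P)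

namespace TernaryWords

/-- The alphabet `{L, X, R}`. -/
inductive Letter where
  | L
  | X
  | R

namespace Letter

/-- The position of a letter in the order `L < X < R`. -/
def rank : Letter → ℕ
  | L => 0
  | X => 1
  | R => 2

theorem rank_injective : Function.Injective rank := by
  intro a b h
  cases a <;> cases b <;> first | rfl | simp [rank] at h

/-- The order `L < X < R`. -/
instance : LinearOrder Letter := LinearOrder.lift' rank rank_injective

end Letter

open Letter

/-- Finite words over `{L, X, R}`. The relation `<` on `Word` is the lexicographic order of lists,
in which a proper initial segment of a word is smaller than the word. -/
abbrev Word := List Letter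

/-- The strict order `w ≺ w'`: for some `i` the letters at `i` are `(L, R)`, and `w j ≤ w' j` for
all `j < i`. -/
def Prec (w w' : Word) : Prop :=
  ∃ (i : ℕ) (h : i < w.length) (h' : i < w'.length), w[i] = L ∧ w'[i] = R ∧
    ∀ (j : ℕ) (hj : j < i), w[j] ≤ w'[j]

/-- The order `w ⪯ w'` on words. -/
def PrecEq (w w' : Word) : Prop := Prec w w' ∨ w = w'

/-- The relation `w ⊥ w'`. -/
def Perp (w w' : Word) : Prop :=
  (∃ (i : ℕ) (h : i < w.length) (h' : i < w'.length), w[i] < w'[i]) ∧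
    (∃ (j : ℕ) (h : j < w.length) (h' : j < w'.length), w'[j] < w[j])

/-- Two words are related if `w ⪯ w'`, `w' ⪯ w` or `w ⊥ w'`. -/
def Related (w w' : Word) : Prop := PrecEq w w' ∨ PrecEq w' w ∨ Perp w w'

/-- The set of all initial segments of the words in `S`. -/
def closure (S : Set Word) : Set Word := {u | ∃ w ∈ S, ∃ i ≤ w.length, u = w.take i}

/-- The set of words of length `i` in `S`. -/
def level (S : Set Word) (i : ℕ) : Set Word := {w ∈ S | w.length = i}

/-- `w` is a leaf of `S`: it lies in `S` and no word of `S` properly extends it. -/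
def IsLeaf (S : Set Word) (w : Word) : Prop := w ∈ S ∧ ∀ w' ∈ S, w <+: w' → w' = w

/-- The word `w` followed by the letter `c`. -/
def snoc (w : Word) (c : Letter) : Word := w ++ [c]

/-- All words of `A` followed by the letter `c`. -/
def ext (A : Set Word) (c : Letter) : Set Word := (fun w => snoc w c) '' A

/-- Leaf: `A` and `B` are consecutive levels, one word of `A` ends here. -/
def LeafStep (A B : Set Word) : Prop :=
  ∃ w ∈ A, (∀ u ∈ A \ {w}, Related w u) ∧ B = ext (A \ {w}) X

/-- Branching: one word of `A` splits into two words of `B`. -/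
def BranchingStep (A B : Set Word) : Prop :=
  ∃ w ∈ A, B = ext {z ∈ A | z < w} X ∪ {snoc w X, snoc w R} ∪ ext {z ∈ A | w < z} R

/-- New `⊥`. -/
def NewPerpStep (A B : Set Word) : Prop :=
  ∃ v ∈ A, ∃ w ∈ A, v < w ∧ ¬ Related v w ∧
    B = ext {z ∈ A | z < v} X ∪ {snoc v R} ∪
        ext {z ∈ A | v < z ∧ z < w ∧ Perp z v} X ∪
        ext {z ∈ A | v < z ∧ z < w ∧ ¬ Perp z v} R ∪
        {snoc w X} ∪ ext {z ∈ A | w < z} R ∧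
    ∀ u ∈ A, v < u → u < w → Perp u v ∨ Perp u w

/-- New `⪯`. -/
def NewPrecStep (A B : Set Word) : Prop :=
  ∃ v ∈ A, ∃ w ∈ A, v < w ∧ ¬ Related v w ∧
    B = ext {z ∈ A | z < v ∧ Perp z v} X ∪ ext {z ∈ A | z < v ∧ ¬ Perp z v} L ∪
        {snoc v L} ∪ ext {z ∈ A | v < z ∧ z < w} X ∪ {snoc w R} ∪
        ext {z ∈ A | w < z ∧ Perp w z} X ∪ ext {z ∈ A | w < z ∧ ¬ Perp w z} R ∧
    (∀ u ∈ A, u < v → PrecEq u w ∨ Perp u v) ∧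
    (∀ u ∈ A, w < u → PrecEq v u ∨ Perp w u)

/-- The four kinds of levels. -/
inductive LevelKind where
  | leaf
  | branching
  | newPerp
  | newPrec

/-- The condition on two consecutive levels `A`, `B` that belongs to a kind of level. -/
def LevelKind.Holds : LevelKind → Set Word → Set Word → Prop
  | leaf => LeafStep
  | branching => BranchingStep
  | newPerp => NewPerpStep
  | newPrec => NewPrecStep

/-- `S` is a poset-type: it is closed under initial segments and, for every `i` that is smaller
than the length of some word of `S`, precisely one of the four conditions holds. -/
def IsPosetType (S : Set Word) : Prop :=
  S = closure S ∧
    ∀ i : ℕ, (∃ w ∈ S, i < w.length) →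
      ∃! k : LevelKind, k.Holds (level S i) (level S (i + 1))

end TernaryWords

namespace TernaryWords

open Letter

/-! ### Letters and words -/

/-! Enumerate `P` and let the words of all its elements grow together, one letter per level; at
stage `n` the word of the `n`-th element stops and becomes a leaf. Elements still growing share a
word as long as they have the same type over the set `F` of elements already stopped. The invariant
is `Matches`: the word of `q` lies pointwise below that of `q'` (`Dom`) exactly when the type of `q`
lies below that of `q'` (`TypeLE`), and `≺` holds exactly when an element of `F` separates `q < q'`.
Note that `⊥` is the failure of `Dom` in both directions.

To stop `p`, it is first added to `F`. Branching steps split the words by position relative to `p`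
(`Grown.exists_refine`). New `⊥` steps then destroy surplus dominance, one pair of words at a time
(`Grown.exists_dom_iff`), and New `⪯` steps create the missing `≺` (`Grown.exists_prec_iff`). The
side conditions of these steps guarantee that no other pair changes, and an extremal choice of the
pair satisfies them. Once `p` is in `F`, its word is related to every other growing word, so a leaf
step can end it (`Grown.exists_remove`). Finished levels and leaves never change again, so the
stages have a limit. -/

theorem Letter.L_le (x : Letter) : L ≤ x := by cases x <;> decide

theorem Letter.le_R (x : Letter) : x ≤ R := by cases x <;> decide

instance : Finite Letter :=
  Finite.of_surjective (fun n : Fin 3 => if n = 0 then L else if n = 1 then X else R) (by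
    intro b
    cases b
    exacts [⟨0, rfl⟩, ⟨1, rfl⟩, ⟨2, rfl⟩])

/-- The pointwise order of the common part of two words. -/
def Dom (a b : Word) : Prop := ∀ (i : ℕ) (h : i < a.length) (h' : i < b.length), a[i] ≤ b[i]

theorem perp_iff {a b : Word} : Perp a b ↔ ¬ Dom b a ∧ ¬ Dom a b := by
  simp only [Perp, Dom, not_forall, not_le]
  constructor
  · rintro ⟨⟨i, h, h', hi⟩, j, k, k', hj⟩
    exact ⟨⟨i, h', h, hi⟩, j, k, k', hj⟩
  · rintro ⟨⟨i, h, h', hi⟩, j, k, k', hj⟩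
    exact ⟨⟨i, h', h, hi⟩, j, k, k', hj⟩

theorem Dom.refl (a : Word) : Dom a a := fun _ _ _ => le_rfl

theorem Dom.trans {a b c : Word} (hl : a.length = b.length) (h : Dom a b) (h' : Dom b c) :
    Dom a c :=
  fun i hi hi' => (h i hi (hl ▸ hi)).trans (h' i (hl ▸ hi) hi')

theorem Dom.le {a b : Word} (hl : a.length = b.length) (h : Dom a b) : a ≤ b := by
  refine le_of_not_gt fun hlt => ?_
  rcases List.lt_iff_exists.1 hlt with ⟨_, h2⟩ | ⟨i, h1, h2, _, h3⟩
  · omega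
  · exact absurd h3 (not_lt.2 (h i h2 h1))

theorem Prec.lt {a b : Word} (hl : a.length = b.length) (h : Prec a b) : a < b := by
  obtain ⟨i, hi, hi', ha, hb, hj⟩ := h
  refine lt_of_not_ge fun hle => ?_
  rcases hle.lt_or_eq with hlt | rfl
  · rcases List.lt_iff_exists.1 hlt with ⟨_, h2⟩ | ⟨k, h1, h2, h3, h4⟩
    · omega
    · rcases lt_trichotomy k i with hk | rfl | hk
      · exact absurd h4 (not_lt.2 (hj k hk))
      · rw [ha, hb] at h4
        exact absurd h4 (by decide)
      · have := h3 i hk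
        rw [ha, hb] at this
        exact absurd this (by decide)
  · rw [ha] at hb
    exact absurd hb (by decide)

theorem length_snoc (a : Word) (x : Letter) : (snoc a x).length = a.length + 1 := by simp [snoc]

theorem snoc_inj {a b : Word} {x y : Letter} : snoc a x = snoc b y ↔ a = b ∧ x = y := by
  simp [snoc]

theorem snoc_lt_snoc {a b : Word} (hl : a.length = b.length) {x y : Letter} :
    snoc a x < snoc b y ↔ a < b ∨ a = b ∧ x < y := by
  induction a generalizing b with
  | nil =>
    obtain rfl : b = [] := List.eq_nil_of_length_eq_zero hl.symm
    simp [snoc, List.cons_lt_cons_iff]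
  | cons c a ih =>
    cases b with
    | nil => simp at hl
    | cons d b =>
      have := ih (b := b) (by simpa using hl)
      simp only [snoc, List.cons_append, List.cons_lt_cons_iff, List.cons.injEq] at this ⊢
      rw [this]
      tauto

theorem dom_snoc {a b : Word} (hl : a.length = b.length) {x y : Letter} :
    Dom (snoc a x) (snoc b y) ↔ Dom a b ∧ x ≤ y := by
  constructor
  · refine fun h => ⟨fun i hi hi' => ?_, ?_⟩
    · have := h i (by simp [snoc]; omega) (by simp [snoc]; omega)
      simpa [snoc, List.getElem_append_left, hi, hi'] using this
    · have := h a.length (by simp [snoc]) (by simp [snoc]; omega)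
      simpa [snoc, List.getElem_append_right, hl] using this
  · rintro ⟨h, hxy⟩ i hi hi'
    rw [length_snoc] at hi
    rcases Nat.lt_succ_iff_lt_or_eq.1 hi with hi | rfl
    · simpa [snoc, List.getElem_append_left, hi, hl ▸ hi] using h i hi (hl ▸ hi)
    · simpa [snoc, List.getElem_append_right, hl] using hxy

/-- A last letter can create `≺` only as the pair `(L, R)`, and only while dominance has not been
lost. Steps that never append `L` therefore leave `≺` alone. -/
theorem prec_snoc {a b : Word} (hl : a.length = b.length) {x y : Letter} :
    Prec (snoc a x) (snoc b y) ↔ Prec a b ∨ Dom a b ∧ x = L ∧ y = R := by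
  constructor
  · rintro ⟨i, hi, hi', ha, hb, hj⟩
    have hlt : ∀ j, j < i → ∀ (h : j < a.length) (h' : j < b.length), a[j] ≤ b[j] := by
      intro j hji h h'
      simpa [snoc, List.getElem_append_left, h, h'] using hj j hji
    rw [length_snoc] at hi
    rcases Nat.lt_succ_iff_lt_or_eq.1 hi with hi | rfl
    · refine Or.inl ⟨i, hi, hl ▸ hi, ?_, ?_, fun j hji => hlt j hji _ _⟩
      · simpa [snoc, List.getElem_append_left, hi] using ha
      · simpa [snoc, List.getElem_append_left, hl ▸ hi] using hb
    · refine Or.inr ⟨fun j h h' => hlt j h h h', ?_, ?_⟩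
      · simpa [snoc, List.getElem_append_right] using ha
      · simpa [snoc, List.getElem_append_right, hl] using hb
  · rintro (⟨i, hi, hi', ha, hb, hj⟩ | ⟨h, rfl, rfl⟩)
    · refine ⟨i, by rw [length_snoc]; omega, by rw [length_snoc]; omega, ?_, ?_, fun j hji => ?_⟩
      · simpa [snoc, List.getElem_append_left, hi] using ha
      · simpa [snoc, List.getElem_append_left, hi'] using hb
      · simpa [snoc, List.getElem_append_left, hji.trans hi, hji.trans hi'] using hj j hji
    · refine ⟨a.length, by simp [snoc], by simp [snoc, hl], ?_, ?_, fun j hji => ?_⟩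
      · simp [snoc]
      · simp [snoc, hl]
      · have hji' : j < b.length := hl ▸ hji
        simpa [snoc, List.getElem_append_left, hji, hji'] using h j hji hji'

/-- All indices that matter for `≺` lie below both lengths. Hence the relations of a leaf to a
growing word are frozen from the moment the leaf stops. -/
theorem prec_append_right {a b : Word} (hl : a.length ≤ b.length) (c : Word) :
    Prec a (b ++ c) ↔ Prec a b := by
  constructor
  · rintro ⟨i, hi, hi', ha, hb, hj⟩
    refine ⟨i, hi, hi.trans_le hl, ha, ?_, fun j hji => ?_⟩
    · simpa [List.getElem_append_left, hi.trans_le hl] using hb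
    · simpa [List.getElem_append_left, (hji.trans hi).trans_le hl] using hj j hji
  · rintro ⟨i, hi, hi', ha, hb, hj⟩
    refine ⟨i, hi, by simp; omega, ha, ?_, fun j hji => ?_⟩
    · simpa [List.getElem_append_left, hi'] using hb
    · simpa [List.getElem_append_left, hji.trans hi'] using hj j hji

theorem prec_append_left {a b : Word} (hl : b.length ≤ a.length) (c : Word) :
    Prec (a ++ c) b ↔ Prec a b := by
  constructor
  · rintro ⟨i, hi, hi', ha, hb, hj⟩
    refine ⟨i, hi'.trans_le hl, hi', ?_, hb, fun j hji => ?_⟩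
    · simpa [List.getElem_append_left, hi'.trans_le hl] using ha
    · simpa [List.getElem_append_left, (hji.trans hi').trans_le hl] using hj j hji
  · rintro ⟨i, hi, hi', ha, hb, hj⟩
    refine ⟨i, by simp; omega, hi', ?_, hb, fun j hji => ?_⟩
    · simpa [List.getElem_append_left, hi] using ha
    · simpa [List.getElem_append_left, hji.trans hi] using hj j hji

/-! ### The four kinds of levels -/

open Classical in
/-- The letter that the word `z` receives in a step that makes `v` and `w` perpendicular. -/
noncomputable def perpLetter (v w z : Word) : Letter :=
  if z < v then X else if z = v then R else if z < w then (if Perp z v then X else R)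
  else if z = w then X else R

open Classical in
/-- The letter that the word `z` receives in a step that introduces `v ≺ w`. -/
noncomputable def precLetter (v w z : Word) : Letter :=
  if z < v then (if Perp z v then X else L) else if z = v then L else if z < w then X
  else if z = w then R else if Perp w z then X else R

theorem image_perpLetter {A : Set Word} {v w : Word} (hv : v ∈ A) (hw : w ∈ A) (hvw : v < w) :
    (fun z => snoc z (perpLetter v w z)) '' A =
      ext {z ∈ A | z < v} X ∪ {snoc v R} ∪
        ext {z ∈ A | v < z ∧ z < w ∧ Perp z v} X ∪
        ext {z ∈ A | v < z ∧ z < w ∧ ¬ Perp z v} R ∪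
        {snoc w X} ∪ ext {z ∈ A | w < z} R := by
  ext x
  simp only [ext, Set.mem_image, Set.mem_union, Set.mem_ofPred_eq, Set.mem_singleton_iff]
  constructor
  · rintro ⟨z, hz, rfl⟩
    simp only [snoc_inj, perpLetter]
    rcases lt_trichotomy z v with h | rfl | h
    · grind
    · grind
    · rcases lt_trichotomy z w with h' | rfl | h'
      · by_cases hp : Perp z v <;> grind
      · grind
      · grind
  · unfold perpLetter
    grind

theorem image_precLetter {A : Set Word} {v w : Word} (hv : v ∈ A) (hw : w ∈ A) (hvw : v < w) :
    (fun z => snoc z (precLetter v w z)) '' A =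
      ext {z ∈ A | z < v ∧ Perp z v} X ∪ ext {z ∈ A | z < v ∧ ¬ Perp z v} L ∪
        {snoc v L} ∪ ext {z ∈ A | v < z ∧ z < w} X ∪ {snoc w R} ∪
        ext {z ∈ A | w < z ∧ Perp w z} X ∪ ext {z ∈ A | w < z ∧ ¬ Perp w z} R := by
  ext x
  simp only [ext, Set.mem_image, Set.mem_union, Set.mem_ofPred_eq, Set.mem_singleton_iff]
  constructor
  · rintro ⟨z, hz, rfl⟩
    simp only [snoc_inj, precLetter]
    rcases lt_trichotomy z v with h | rfl | h
    · by_cases hp : Perp z v <;> grind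
    · grind
    · rcases lt_trichotomy z w with h' | rfl | h'
      · grind
      · grind
      · by_cases hp : Perp w z <;> grind
  · unfold precLetter
    grind

theorem newPerpStep_image {A : Set Word} {v w : Word} (hv : v ∈ A) (hw : w ∈ A) (hvw : v < w)
    (hr : ¬ Related v w) (hu : ∀ u ∈ A, v < u → u < w → Perp u v ∨ Perp u w) :
    NewPerpStep A ((fun z => snoc z (perpLetter v w z)) '' A) :=
   ⟨v, hv, w, hw, hvw, hr, image_perpLetter hv hw hvw, hu⟩

theorem newPrecStep_image {A : Set Word} {v w : Word} (hv : v ∈ A) (hw : w ∈ A) (hvw : v < w)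
    (hr : ¬ Related v w) (hu : ∀ u ∈ A, u < v → PrecEq u w ∨ Perp u v)
    (hu' : ∀ u ∈ A, w < u → PrecEq v u ∨ Perp w u) :
    NewPrecStep A ((fun z => snoc z (precLetter v w z)) '' A) :=
   ⟨v, hv, w, hw, hvw, hr, image_precLetter hv hw hvw, hu, hu'⟩

theorem LeafStep.exists_not_mem {A B : Set Word} (h : LeafStep A B) :
    ∃ w ∈ A, ∀ c, snoc w c ∉ B := by
  obtain ⟨w, hw, -, rfl⟩ := h
  refine ⟨w, hw, fun c => ?_⟩
  simp [ext, snoc_inj]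

theorem BranchingStep.exists_mem {A B : Set Word} (h : BranchingStep A B) {z : Word}
    (hz : z ∈ A) : ∃ c, snoc z c ∈ B := by
  obtain ⟨w, hw, rfl⟩ := h
  simp only [ext, Set.mem_union, Set.mem_image, Set.mem_ofPred_eq, Set.mem_insert_iff,
    Set.mem_singleton_iff, snoc_inj]
  rcases lt_trichotomy z w with h | rfl | h <;> grind

theorem BranchingStep.exists_two {A B : Set Word} (h : BranchingStep A B) :
    ∃ w, snoc w X ∈ B ∧ snoc w R ∈ B := by
  obtain ⟨w, hw, rfl⟩ := h
  exact ⟨w, by simp, by simp⟩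

theorem NewPerpStep.exists_eq_image {A B : Set Word} (h : NewPerpStep A B) :
    ∃ c : Word → Letter, (∀ z, c z ≠ L) ∧ B = (fun z => snoc z (c z)) '' A := by
  obtain ⟨v, hv, w, hw, hvw, -, rfl, -⟩ := h
  exact ⟨perpLetter v w, fun z => by unfold perpLetter; split_ifs <;> decide,
    (image_perpLetter hv hw hvw).symm⟩

theorem NewPrecStep.exists_eq_image {A B : Set Word} (h : NewPrecStep A B) :
    ∃ c : Word → Letter, (∃ z ∈ A, c z = L) ∧ B = (fun z => snoc z (c z)) '' A := by
  obtain ⟨v, hv, w, hw, hvw, -, rfl, -⟩ := h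
  exact ⟨precLetter v w, ⟨v, hv, by simp [precLetter]⟩, (image_precLetter hv hw hvw).symm⟩

/-- The kinds are told apart by successors: a leaf step leaves some word without one, a branching
step gives some word two, and the other two steps give each word exactly one. New `⊥` never appends
`L`, whereas New `⪯` appends `L` to `v`. -/
theorem LevelKind.holds_unique {A B : Set Word} {k l : LevelKind} (hk : k.Holds A B)
    (hl : l.Holds A B) : k = l := by
  have leaf_branching : LeafStep A B → BranchingStep A B → False := fun h h' => by
    obtain ⟨w, hw, hB⟩ := h.exists_not_mem
    obtain ⟨c, hc⟩ := h'.exists_mem hw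
    exact hB c hc
  have leaf_image : LeafStep A B → ¬ ∃ c : Word → Letter, B = (fun z => snoc z (c z)) '' A := by
    rintro h ⟨c, rfl⟩
    obtain ⟨w, hw, hB⟩ := h.exists_not_mem
    exact hB (c w) ⟨w, hw, rfl⟩
  have branching_image :
      BranchingStep A B → ¬ ∃ c : Word → Letter, B = (fun z => snoc z (c z)) '' A := by
    rintro h ⟨c, rfl⟩
    obtain ⟨w, ⟨a, -, ha⟩, ⟨b, -, hb⟩⟩ := h.exists_two
    obtain ⟨rfl, ha'⟩ := snoc_inj.1 ha
    obtain ⟨rfl, hb'⟩ := snoc_inj.1 hb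
    exact absurd (ha'.symm.trans hb') (by decide)
  have perp_prec : NewPerpStep A B → NewPrecStep A B → False := fun h h' => by
    obtain ⟨c, hc, rfl⟩ := h.exists_eq_image
    obtain ⟨d, ⟨z, hz, hd⟩, he⟩ := h'.exists_eq_image
    obtain ⟨y, -, hy⟩ := he.ge ⟨z, hz, rfl⟩
    exact hc y ((snoc_inj.1 hy).2.trans hd)
  have perp : NewPerpStep A B → ∃ c : Word → Letter, B = (fun z => snoc z (c z)) '' A :=
    fun h => let ⟨c, _, hc⟩ := h.exists_eq_image; ⟨c, hc⟩
  have prec : NewPrecStep A B → ∃ c : Word → Letter, B = (fun z => snoc z (c z)) '' A :=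
    fun h => let ⟨c, _, hc⟩ := h.exists_eq_image; ⟨c, hc⟩
  cases k <;> cases l <;> simp only [LevelKind.Holds] at hk hl <;> first | rfl | tauto

theorem Prec.trans_dom {a b c : Word} (hl : b.length = c.length) (h : Prec a b) (h' : Dom b c) :
    Prec a c := by
  obtain ⟨i, hi, hi', ha, hb, hj⟩ := h
  refine ⟨i, hi, hl ▸ hi', ha, ?_, fun j hji => ?_⟩
  · exact le_antisymm (Letter.le_R _) (hb ▸ h' i hi' (hl ▸ hi'))
  · exact (hj j hji).trans (h' j (hji.trans hi') (hl ▸ hji.trans hi'))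

theorem perp_comm {a b : Word} : Perp a b ↔ Perp b a := by
  rw [perp_iff, perp_iff, and_comm]

theorem perp_iff_of_lt {a b : Word} (hl : a.length = b.length) (h : a < b) :
    Perp a b ↔ ¬ Dom a b := by
  rw [perp_iff]
  exact ⟨fun h => h.2, fun h' => ⟨fun h'' => absurd (h''.le hl.symm) (not_le.2 h), h'⟩⟩

theorem perpLetter_ne_L (v w z : Word) : perpLetter v w z ≠ L := by
  unfold perpLetter
  split_ifs <;> decide

/-- In a step that makes `v` and `w` perpendicular no other pair of words becomes
perpendicular. -/
theorem perpLetter_le_iff {v w a b : Word} (ha : a.length = v.length) (hb : b.length = v.length)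
    (hvw : v < w) (hu : v < a → a < w → Dom v a → ¬ Dom a w) (hab : Dom a b) :
    perpLetter v w a ≤ perpLetter v w b ↔ ¬ (a = v ∧ b = w) := by
  have hle := hab.le (ha.trans hb.symm)
  have hpa : v < a → (Perp a v ↔ ¬ Dom v a) := fun h => by
    rw [perp_comm, perp_iff_of_lt ha.symm h]
  have hpb : v < b → (Perp b v ↔ ¬ Dom v b) := fun h => by
    rw [perp_comm, perp_iff_of_lt hb.symm h]
  have htr : Dom v a → Dom v b := fun h => h.trans ha.symm hab
  have hXX : X ≤ X := le_rfl
  have hRR : R ≤ R := le_rfl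
  have hXR : X ≤ R := by decide
  have hRX : ¬ R ≤ X := by decide
  have hvb : a = v → Dom v b := fun h => h ▸ hab
  have haw : b = w → Dom a w := fun h => h ▸ hab
  have h1 := lt_trichotomy a v
  have h2 := lt_trichotomy a w
  have h3 := lt_trichotomy b v
  have h4 := lt_trichotomy b w
  have h5 : b < v → a < v := fun h => hle.trans_lt h
  have h6 : b < w → a < w := fun h => hle.trans_lt h
  have h7 : v < a → v < b := fun h => h.trans_le hle
  have h8 : w < a → w < b := fun h => h.trans_le hle
  have h9 : a < v → ¬ v < a := fun h => h.not_gt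
  have h10 : b < v → ¬ v < b := fun h => h.not_gt
  have h11 : a < w → ¬ w < a := fun h => h.not_gt
  have h12 : b < w → ¬ w < b := fun h => h.not_gt
  -- Only `R` against `X` can fail. If `a` lies beyond `w`, so does `b`, which gets `R`. Otherwise
  -- an `a` with letter `R` dominates `v`, hence so does `b`; such a `b` gets `X` only if `b = w`,
  -- and then `hu` forces `a = v`.
  unfold perpLetter
  split_ifs <;> grind

/-- A step that introduces `v ≺ w` creates no perpendicular pair of words. -/
theorem precLetter_mono {v w a b : Word} (ha : a.length = v.length) (hb : b.length = v.length)
    (hw : w.length = v.length) (hab : Dom a b) :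
    precLetter v w a ≤ precLetter v w b := by
  have hle := hab.le (ha.trans hb.symm)
  have hpa : a < v → (Perp a v ↔ ¬ Dom a v) := fun h => perp_iff_of_lt ha h
  have hpb : b < v → (Perp b v ↔ ¬ Dom b v) := fun h => perp_iff_of_lt hb h
  have hpa' : w < a → (Perp w a ↔ ¬ Dom w a) := fun h => perp_iff_of_lt (hw.trans ha.symm) h
  have hpb' : w < b → (Perp w b ↔ ¬ Dom w b) := fun h => perp_iff_of_lt (hw.trans hb.symm) h
  have htr : Dom b v → Dom a v := fun h => hab.trans (ha.trans hb.symm) h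
  have htr' : Dom w a → Dom w b := fun h => h.trans (hw.trans ha.symm) hab
  have hvb : b = v → Dom a v := fun h => h ▸ hab
  have haw : a = w → Dom w b := fun h => h ▸ hab
  have hXX : X ≤ X := le_rfl
  have hRR : ∀ x, x ≤ R := Letter.le_R
  have hLL : ∀ x, L ≤ x := Letter.L_le
  have h1 := lt_trichotomy a v
  have h2 := lt_trichotomy a w
  have h3 := lt_trichotomy b v
  have h4 := lt_trichotomy b w
  have h5 : b < v → a < v := fun h => hle.trans_lt h
  have h6 : b < w → a < w := fun h => hle.trans_lt h
  have h7 : v < a → v < b := fun h => h.trans_le hle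
  have h8 : w < a → w < b := fun h => h.trans_le hle
  have h9 : a < v → ¬ v < a := fun h => h.not_gt
  have h10 : b < v → ¬ v < b := fun h => h.not_gt
  have h11 : a < w → ¬ w < a := fun h => h.not_gt
  have h12 : b < w → ¬ w < b := fun h => h.not_gt
  -- `L` goes to the words dominated by `v`, a down-set for `Dom`, and `R` to an up-set of words
  -- dominating `w`.
  unfold precLetter
  split_ifs <;> grind

/-- In a step that introduces `v ≺ w` no other pair of words becomes related by `≺`. -/
theorem precLetter_eq {v w a b : Word} (ha : a.length = v.length) (hb : b.length = v.length)
    (hw : w.length = v.length)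
    (hu : a < v → Dom a v → Prec a w) (hu' : w < b → Dom w b → Prec v b)
    (hL : precLetter v w a = L) (hR : precLetter v w b = R) :
    Prec a b ∨ a = v ∧ b = w := by
  have hA : a = v ∨ a < v ∧ Dom a v := by
    have hpa : a < v → (Perp a v ↔ ¬ Dom a v) := fun h => perp_iff_of_lt ha h
    have h1 := lt_trichotomy a v
    unfold precLetter at hL
    split_ifs at hL <;> grind
  have hB : b = w ∨ w < b ∧ Dom w b := by
    have hpb' : w < b → (Perp w b ↔ ¬ Dom w b) := fun h => perp_iff_of_lt (hw.trans hb.symm) h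
    have h1 := lt_trichotomy b w
    unfold precLetter at hR
    split_ifs at hR <;> grind
  rcases hA with rfl | ⟨h1, h2⟩ <;> rcases hB with rfl | ⟨h3, h4⟩
  · exact Or.inr ⟨rfl, rfl⟩
  · exact Or.inl (hu' h3 h4)
  · exact Or.inl (hu h1 h2)
  · exact Or.inl ((hu h1 h2).trans_dom (hw.trans hb.symm) h4)

theorem precLetter_left (v w : Word) : precLetter v w v = L := by simp [precLetter]

theorem precLetter_right {v w : Word} (h : v < w) : precLetter v w w = R := by
  simp [precLetter, h.not_gt, h.ne']

/-! ### Growing families of words -/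

section

variable {P : Type*}

/-- The initial segments of length `j` of the words `f p`. -/
def segments (f : P → Word) (j : ℕ) : Set Word := {u | ∃ p, j ≤ (f p).length ∧ u = (f p).take j}

/-- The words in `f` have been grown up to level `i`: the elements of `Q` are those whose words are
still growing, all other words are leaves and are placed correctly with respect to `≺`. -/
structure Grown [PartialOrder P] (f : P → Word) (Q : Set P) (i : ℕ) : Prop where
  length_eq : ∀ q ∈ Q, (f q).length = i
  length_lt : ∀ p ∉ Q, (f p).length < i
  holds : ∀ j < i, ∃ k : LevelKind, k.Holds (segments f j) (segments f (j + 1))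
  leaf : ∀ p ∉ Q, ∀ q, f p <+: f q → p = q
  prec : ∀ p ∉ Q, ∀ q, q ≠ p → (Prec (f p) (f q) ↔ p < q) ∧ (Prec (f q) (f p) ↔ q < p)

/-- The words in `f'` (grown up to level `i'`) are obtained from those in `f` (grown up to level
`i`) by prolonging those with index in `Q`. -/
structure Prolongs (f : P → Word) (Q : Set P) (i : ℕ) (f' : P → Word) (i' : ℕ) : Prop where
  le : i ≤ i'
  prefix_apply : ∀ p, f p <+: f' p
  apply_eq : ∀ p ∉ Q, f' p = f p

theorem Prolongs.refl (f : P → Word) (Q : Set P) (i : ℕ) : Prolongs f Q i f i :=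
  ⟨le_rfl, fun _ => List.prefix_refl _, fun _ _ => rfl⟩

theorem Prolongs.trans {f g h : P → Word} {Q Q' : Set P} {i j k : ℕ} (hQ : Q' ⊆ Q)
    (h₁ : Prolongs f Q i g j) (h₂ : Prolongs g Q' j h k) : Prolongs f Q i h k :=
  ⟨h₁.le.trans h₂.le, fun p => (h₁.prefix_apply p).trans (h₂.prefix_apply p),
    fun p hp => (h₂.apply_eq p fun h => hp (hQ h)).trans (h₁.apply_eq p hp)⟩

/-- Only words that have reached length `i` are prolonged, so conditions verified on earlier levels
persist, also in the limit. -/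
theorem Prolongs.segments_eq {f f' : P → Word} {Q : Set P} {i i' j : ℕ}
    (h : Prolongs f Q i f' i') (hf : ∀ q ∈ Q, (f q).length = i) (hj : j ≤ i) :
    segments f' j = segments f j := by
  have key : ∀ p, (j ≤ (f' p).length ↔ j ≤ (f p).length) ∧
      (j ≤ (f p).length → (f' p).take j = (f p).take j) := by
    intro p
    by_cases hp : p ∈ Q
    · have h1 := hf p hp
      obtain ⟨r, hr⟩ := h.prefix_apply p
      rw [← hr]
      refine ⟨by simp; omega, fun h2 => by rw [List.take_append_of_le_length h2]⟩
    · simp [h.apply_eq p hp]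
  ext u
  constructor
  · rintro ⟨p, hp, rfl⟩
    exact ⟨p, (key p).1.1 hp, (key p).2 ((key p).1.1 hp)⟩
  · rintro ⟨p, hp, rfl⟩
    exact ⟨p, (key p).1.2 hp, ((key p).2 hp).symm⟩

open Classical in
/-- Append the letter `c p` to the words `f p` with `p ∈ Q`. -/
noncomputable def prolong (f : P → Word) (Q : Set P) (c : P → Letter) (p : P) : Word :=
  if p ∈ Q then snoc (f p) (c p) else f p

theorem prolong_of_mem {f : P → Word} {Q : Set P} {c : P → Letter} {p : P} (h : p ∈ Q) :
    prolong f Q c p = snoc (f p) (c p) := if_pos h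

theorem prolong_of_notMem {f : P → Word} {Q : Set P} {c : P → Letter} {p : P} (h : p ∉ Q) :
    prolong f Q c p = f p := if_neg h

theorem prolongs_prolong (f : P → Word) (Q : Set P) (i : ℕ) (c : P → Letter) :
    Prolongs f Q i (prolong f Q c) (i + 1) := by
  refine ⟨Nat.le_succ i, fun p => ?_, fun p hp => prolong_of_notMem hp⟩
  by_cases hp : p ∈ Q
  · rw [prolong_of_mem hp]
    exact List.prefix_append _ _
  · rw [prolong_of_notMem hp]

variable [PartialOrder P] {f : P → Word} {Q : Set P} {i : ℕ}

theorem Grown.segments_eq (h : Grown f Q i) : segments f i = f '' Q := by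
  ext u
  constructor
  · rintro ⟨p, hp, rfl⟩
    have hpQ : p ∈ Q := by
      by_contra hp'
      exact absurd (h.length_lt p hp') (not_lt.2 hp)
    exact ⟨p, hpQ, by rw [← h.length_eq p hpQ, List.take_length]⟩
  · rintro ⟨p, hp, rfl⟩
    exact ⟨p, (h.length_eq p hp).ge, by rw [← h.length_eq p hp, List.take_length]⟩

/-- Treats all kinds of steps at once: `Q' = Q` unless a leaf is dropped. Only the newly dropped
elements need `hleaf` and `hprec`, since older leaves are too short to notice the new letter. -/
theorem Grown.step_subset (h : Grown f Q i) {Q' : Set P} (hQ : Q' ⊆ Q) (c : P → Letter)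
    (k : LevelKind) (hk : k.Holds (f '' Q) ((fun p => snoc (f p) (c p)) '' Q'))
    (hleaf : ∀ p ∈ Q, p ∉ Q' → ∀ q ∈ Q, f p = f q → p = q)
    (hprec : ∀ p ∈ Q, p ∉ Q' → ∀ q ∈ Q, q ≠ p →
      (Prec (f p) (f q) ↔ p < q) ∧ (Prec (f q) (f p) ↔ q < p)) :
    Grown (prolong f Q' c) Q' (i + 1) := by
  have hseg : ∀ j ≤ i, segments (prolong f Q' c) j = segments f j := fun j hj =>
    (prolongs_prolong f Q' i c).segments_eq (fun q hq => h.length_eq q (hQ hq)) hj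
  have hle : ∀ p, (f p).length ≤ i := fun p => by
    by_cases hp : p ∈ Q
    · exact (h.length_eq p hp).le
    · exact (h.length_lt p hp).le
  have hleaf' : ∀ p ∉ Q', ∀ q, f p <+: f q → p = q := by
    intro p hp q hpq
    by_cases hpQ : p ∈ Q
    · have h1 := h.length_eq p hpQ
      have h2 := hpq.length_le
      have hq : q ∈ Q := by
        by_contra hq
        have := h.length_lt q hq
        omega
      exact hleaf p hpQ hp q hq (hpq.eq_of_length (by rw [h1, h.length_eq q hq]))
    · exact h.leaf p hpQ q hpq
  have hprec' : ∀ p ∉ Q', ∀ q, q ≠ p →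
      (Prec (f p) (f q) ↔ p < q) ∧ (Prec (f q) (f p) ↔ q < p) := by
    intro p hp q hqp
    by_cases hpQ : p ∈ Q
    · by_cases hq : q ∈ Q
      · exact hprec p hpQ hp q hq hqp
      · exact (h.prec q hq p hqp.symm).symm
    · exact h.prec p hpQ q hqp
  refine ⟨fun q hq => ?_, fun p hp => ?_, fun j hj => ?_, fun p hp q hpq => ?_,
    fun p hp q hqp => ?_⟩
  · rw [prolong_of_mem hq, length_snoc, h.length_eq q (hQ hq)]
  · rw [prolong_of_notMem hp]
    exact Nat.lt_succ_of_le (hle p)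
  · rcases Nat.lt_succ_iff_lt_or_eq.1 hj with hj | rfl
    · rw [hseg j hj.le, hseg (j + 1) hj]
      exact h.holds j hj
    · refine ⟨k, ?_⟩
      rw [hseg j le_rfl, h.segments_eq]
      convert hk using 1
      ext u
      constructor
      · rintro ⟨p, hp, rfl⟩
        have hpQ : p ∈ Q' := by
          by_contra hpQ
          rw [prolong_of_notMem hpQ] at hp
          have := hle p
          omega
        refine ⟨p, hpQ, ?_⟩
        rw [prolong_of_mem hpQ, List.take_of_length_le]
        rw [length_snoc, h.length_eq p (hQ hpQ)]
      · rintro ⟨p, hp, rfl⟩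
        have hl := h.length_eq p (hQ hp)
        refine ⟨p, ?_, ?_⟩
        · rw [prolong_of_mem hp, length_snoc, hl]
        · rw [prolong_of_mem hp, List.take_of_length_le]
          rw [length_snoc, hl]
  · rw [prolong_of_notMem hp] at hpq
    by_cases hq : q ∈ Q'
    · rw [prolong_of_mem hq] at hpq
      refine hleaf' p hp q (List.prefix_of_prefix_length_le hpq (List.prefix_append _ _) ?_)
      rw [h.length_eq q (hQ hq)]
      exact hle p
    · rw [prolong_of_notMem hq] at hpq
      exact hleaf' p hp q hpq
  · rw [prolong_of_notMem hp]
    by_cases hq : q ∈ Q'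
    · have hl : (f p).length ≤ (f q).length := by
        rw [h.length_eq q (hQ hq)]
        exact hle p
      rw [prolong_of_mem hq, snoc, prec_append_right hl, prec_append_left hl]
      exact hprec' p hp q hqp
    · rw [prolong_of_notMem hq]
      exact hprec' p hp q hqp

theorem Grown.step (h : Grown f Q i) (c : P → Letter) (k : LevelKind)
    (hk : k.Holds (f '' Q) ((fun p => snoc (f p) (c p)) '' Q)) :
    Grown (prolong f Q c) Q (i + 1) :=
  h.step_subset subset_rfl c k hk (fun _ hp hp' => absurd hp hp')
    (fun _ hp hp' => absurd hp hp')

theorem Grown.length_eq_length (h : Grown f Q i) {q r : P} (hq : q ∈ Q) (hr : r ∈ Q) :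
    (f q).length = (f r).length := (h.length_eq q hq).trans (h.length_eq r hr).symm

end

/-! ### Repeating steps of one kind until the relations are as prescribed -/

theorem exists_isLeast_of_finite_image {P τ : Type*} [LinearOrder τ] {t : P → τ} {Q : Set P}
    (hfin : (t '' Q).Finite) {p : P → Prop} (h : ∃ q ∈ Q, p q) :
    ∃ q ∈ Q, p q ∧ ∀ r ∈ Q, p r → t q ≤ t r := by
  obtain ⟨q, hq, hpq⟩ := h
  obtain ⟨x, ⟨r, ⟨hr, hpr⟩, rfl⟩, hmin⟩ := Set.exists_min_image (t '' {q ∈ Q | p q}) id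
    (hfin.subset (Set.image_mono fun _ h => h.1)) ⟨_, q, ⟨hq, hpq⟩, rfl⟩
  exact ⟨r, hr, hpr, fun s hs hps => hmin _ ⟨s, ⟨hs, hps⟩, rfl⟩⟩

section

variable {P τ : Type*} {t : P → τ} {f : P → Word} {Q : Set P}

/-- The pairs of values of `t` that are attained at related elements of `Q`. -/
def relatedValues (t : P → τ) (Q : Set P) (r : P → P → Prop) : Set (τ × τ) :=
  {x | ∃ q ∈ Q, ∃ q' ∈ Q, r q q' ∧ x = (t q, t q')}

/-- The termination measure of the next three inductions. `Q` may be infinite, so bad pairs are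
counted through the finitely many values of `t`; accordingly `hvw'` asks that the pair of values
disappear for all elements attaining it. -/
theorem ncard_relatedValues_lt (hfin : (t '' Q).Finite) {r r' : P → P → Prop}
    (hr : ∀ q ∈ Q, ∀ q' ∈ Q, r' q q' → r q q') {v w : P} (hv : v ∈ Q) (hw : w ∈ Q)
    (hvw : r v w) (hvw' : ∀ q ∈ Q, ∀ q' ∈ Q, t q = t v → t q' = t w → ¬ r' q q') :
    (relatedValues t Q r').ncard < (relatedValues t Q r).ncard := by
  refine Set.ncard_lt_ncard ⟨?_, fun hle => ?_⟩ ((hfin.prod hfin).subset ?_)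
  · rintro _ ⟨q, hq, q', hq', h, rfl⟩
    exact ⟨q, hq, q', hq', hr q hq q' hq' h, rfl⟩
  · obtain ⟨q, hq, q', hq', h, he⟩ := hle ⟨v, hv, w, hw, hvw, rfl⟩
    rw [Prod.mk.injEq] at he
    exact hvw' q hq q' hq' he.1.symm he.2.symm h
  · rintro _ ⟨q, hq, q', hq', h, rfl⟩
    exact ⟨⟨q, hq, rfl⟩, ⟨q', hq', rfl⟩⟩

variable [LinearOrder τ]

theorem eq_iff_of_lt_iff (ht : ∀ q ∈ Q, ∀ q' ∈ Q, f q < f q' ↔ t q < t q') {q q' : P}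
    (hq : q ∈ Q) (hq' : q' ∈ Q) : f q = f q' ↔ t q = t q' := by
  have h1 := ht q hq q' hq'
  have h2 := ht q' hq' q hq
  simp only [eq_iff_le_not_lt, ← not_lt, h1, h2]

/-- A word shared by several values of `t` is split at one of them. Dominance is lost only within a
shared word, and `≺` stays because only `X` and `R` are appended. -/
theorem Grown.exists_refine [PartialOrder P] (hfin : (t '' Q).Finite) {i : ℕ} (h : Grown f Q i)
    (ht : ∀ q ∈ Q, ∀ q' ∈ Q, f q < f q' → t q < t q') :
    ∃ f' i', Prolongs f Q i f' i' ∧ Grown f' Q i' ∧ ∀ q ∈ Q, ∀ q' ∈ Q,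
      (f' q < f' q' ↔ t q < t q') ∧ (Dom (f' q) (f' q') ↔ t q ≤ t q' ∧ Dom (f q) (f q')) ∧
      (Prec (f' q) (f' q') ↔ Prec (f q) (f q')) := by
  induction hN : (relatedValues t Q fun q q' => t q < t q' ∧ f q = f q').ncard
    using Nat.strong_induction_on generalizing f i with
  | _ N ih =>
  subst hN
  by_cases hbad : ∃ v ∈ Q, ∃ w ∈ Q, t v < t w ∧ f v = f w
  · obtain ⟨v, hv, w, hw, hvw, he⟩ := hbad
    -- Cutting all of `Q` at the value `t v` gives the letters of a branching step, because `t`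
    -- refines the lexicographic order by `ht`.
    set c : P → Letter := fun q => if t q ≤ t v then X else R with hc
    have hmono : ∀ q q', t q ≤ t q' → c q ≤ c q' := by
      intro q q' hqq
      simp only [hc]
      split_ifs with h1 h2 h2
      · exact le_rfl
      · exact Letter.le_R _
      · exact absurd (hqq.trans h2) h1
      · exact le_rfl
    have hstep : BranchingStep (f '' Q) ((fun p => snoc (f p) (c p)) '' Q) := by
      refine ⟨f v, ⟨v, hv, rfl⟩, ?_⟩
      have hX : ∀ q ∈ Q, f q < f v → c q = X := fun q hq hlt =>
        if_pos (ht q hq v hv hlt).le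
      have hR : ∀ q ∈ Q, f v < f q → c q = R := fun q hq hlt =>
        if_neg (not_le.2 (ht v hv q hq hlt))
      have hcv : c v = X := if_pos le_rfl
      have hcw : c w = R := if_neg (not_le.2 hvw)
      ext x
      simp only [ext, Set.mem_image, Set.mem_union, Set.mem_ofPred_eq, Set.mem_insert_iff,
        Set.mem_singleton_iff]
      constructor
      · rintro ⟨q, hq, rfl⟩
        rcases lt_trichotomy (f q) (f v) with hlt | heq | hlt
        · exact Or.inl (Or.inl ⟨f q, ⟨⟨q, hq, rfl⟩, hlt⟩, by rw [hX q hq hlt]⟩)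
        · refine Or.inl (Or.inr ?_)
          rw [heq]
          simp only [hc]
          split_ifs <;> simp
        · exact Or.inr ⟨f q, ⟨⟨q, hq, rfl⟩, hlt⟩, by rw [hR q hq hlt]⟩
      · rintro ((⟨_, ⟨⟨q, hq, rfl⟩, hlt⟩, rfl⟩ | (rfl | rfl)) | ⟨_, ⟨⟨q, hq, rfl⟩, hlt⟩, rfl⟩)
        · exact ⟨q, hq, by rw [hX q hq hlt]⟩
        · exact ⟨v, hv, by rw [hcv]⟩
        · exact ⟨w, hw, by rw [hcw, he]⟩
        · exact ⟨q, hq, by rw [hR q hq hlt]⟩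
    have hG := h.step c .branching hstep
    have hlt : ∀ q ∈ Q, ∀ q' ∈ Q, prolong f Q c q < prolong f Q c q' → t q < t q' := by
      intro q hq q' hq' hlt
      rw [prolong_of_mem hq, prolong_of_mem hq',
        snoc_lt_snoc (h.length_eq_length hq hq')] at hlt
      rcases hlt with hlt | ⟨-, hlt⟩
      · exact ht q hq q' hq' hlt
      · exact lt_of_not_ge fun hle => absurd (hmono _ _ hle) (not_le.2 hlt)
    obtain ⟨f', i', hp, hG', hrel⟩ := ih _ (ncard_relatedValues_lt hfin (by
        rintro q hq q' hq' ⟨h1, h2⟩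
        rw [prolong_of_mem hq, prolong_of_mem hq', snoc_inj] at h2
        exact ⟨h1, h2.1⟩) hv hw ⟨hvw, he⟩ (by
        rintro q hq q' hq' h1 h2 ⟨-, h3⟩
        rw [prolong_of_mem hq, prolong_of_mem hq', snoc_inj] at h3
        have h4 : c q = X := if_pos h1.le
        have h5 : c q' = R := if_neg (not_le.2 (h2 ▸ hvw))
        exact absurd (h4.symm.trans (h3.2.trans h5)) (by decide))) hG hlt rfl
    refine ⟨f', i', (prolongs_prolong f Q i c).trans subset_rfl hp, hG',
      fun q hq q' hq' => ⟨(hrel q hq q' hq').1, ?_, ?_⟩⟩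
    · rw [(hrel q hq q' hq').2.1, prolong_of_mem hq, prolong_of_mem hq',
        dom_snoc (h.length_eq_length hq hq')]
      exact and_congr_right fun hle => and_iff_left (hmono _ _ hle)
    · rw [(hrel q hq q' hq').2.2, prolong_of_mem hq, prolong_of_mem hq',
        prec_snoc (h.length_eq_length hq hq')]
      refine or_iff_left fun hL => ?_
      have := hL.2.1
      simp only [hc] at this
      split_ifs at this
  · push Not at hbad
    have hlt : ∀ q ∈ Q, ∀ q' ∈ Q, t q < t q' → f q < f q' := by
      intro q hq q' hq' hlt
      rcases lt_trichotomy (f q) (f q') with h1 | h1 | h1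
      · exact h1
      · exact absurd h1 (hbad q hq q' hq' hlt)
      · exact absurd (ht q' hq' q hq h1) hlt.not_gt
    refine ⟨f, i, Prolongs.refl f Q i, h, fun q hq q' hq' =>
      ⟨⟨ht q hq q' hq', hlt q hq q' hq'⟩, ?_, Iff.rfl⟩⟩
    refine ⟨fun hd => ⟨le_of_not_gt fun hgt => ?_, hd⟩, fun hd => hd.2⟩
    exact absurd (hd.le (h.length_eq_length hq hq')) (not_le.2 (hlt q' hq' q hq hgt))

/-- Among surplus pairs take `w` least, then `v` greatest for this `w`. If `u` lay strictly between
them in both orders, the choice of `w` would give `D v u` and that of `v` would give `D u w`, hence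
`D v w`. So New `⊥` applies to `v`, `w`; by `hP` they are unrelated. -/
theorem Grown.exists_dom_iff [PartialOrder P] (hfin : (t '' Q).Finite) {i : ℕ} (h : Grown f Q i)
    (ht : ∀ q ∈ Q, ∀ q' ∈ Q, f q < f q' ↔ t q < t q') {D : P → P → Prop}
    (hrefl : ∀ q ∈ Q, ∀ q' ∈ Q, t q = t q' → D q q')
    (htrans : ∀ q ∈ Q, ∀ q' ∈ Q, ∀ r ∈ Q, D q q' → D q' r → D q r)
    (hD : ∀ q ∈ Q, ∀ q' ∈ Q, D q q' → Dom (f q) (f q'))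
    (hP : ∀ q ∈ Q, ∀ q' ∈ Q, Prec (f q) (f q') → D q q') :
    ∃ f' i', Prolongs f Q i f' i' ∧ Grown f' Q i' ∧ ∀ q ∈ Q, ∀ q' ∈ Q,
      (f' q < f' q' ↔ t q < t q') ∧ (Dom (f' q) (f' q') ↔ D q q') ∧
      (Prec (f' q) (f' q') ↔ Prec (f q) (f q')) := by
  induction hN : (relatedValues t Q fun q q' => Dom (f q) (f q') ∧ ¬ D q q').ncard
    using Nat.strong_induction_on generalizing f i with
  | _ N ih =>
  subst hN
  by_cases hbad : ∃ w ∈ Q, ∃ v ∈ Q, Dom (f v) (f w) ∧ ¬ D v w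
  · obtain ⟨w, hw, hvw, hwmin⟩ := exists_isLeast_of_finite_image hfin hbad
    obtain ⟨v, hv, ⟨hdom, hnD⟩, hvmax⟩ :=
      exists_isLeast_of_finite_image (τ := τᵒᵈ) (t := t) hfin hvw
    have hle := hdom.le (h.length_eq_length hv hw)
    have hlt : f v < f w := lt_of_le_of_ne hle fun he =>
      hnD (hrefl v hv w hw ((eq_iff_of_lt_iff ht hv hw).1 he))
    have hbetween : ∀ u ∈ Q, f v < f u → f u < f w → Dom (f v) (f u) → ¬ Dom (f u) (f w) := by
      intro u hu h1 h2 h3 h4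
      refine hnD (htrans v hv u hu w hw ?_ ?_)
      · by_contra hn
        exact absurd (hwmin u hu ⟨v, hv, h3, hn⟩) (not_le.2 ((ht u hu w hw).1 h2))
      · by_contra hn
        have : t u ≤ t v := hvmax u hu ⟨h4, hn⟩
        exact absurd this (not_le.2 ((ht v hv u hu).1 h1))
    have hnrel : ¬ Related (f v) (f w) := by
      rintro ((h1 | h1) | (h1 | h1) | h1)
      · exact hnD (hP v hv w hw h1)
      · exact hlt.ne h1
      · exact (h1.lt (h.length_eq_length hw hv)).not_gt hlt
      · exact hlt.ne' h1
      · exact (perp_iff.1 h1).2 hdom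
    set c : P → Letter := fun q => perpLetter (f v) (f w) (f q) with hc
    have hstep : NewPerpStep (f '' Q) ((fun p => snoc (f p) (c p)) '' Q) := by
      have := newPerpStep_image (A := f '' Q) ⟨v, hv, rfl⟩ ⟨w, hw, rfl⟩ hlt hnrel (by
        rintro _ ⟨u, hu, rfl⟩ h1 h2
        rw [perp_comm, perp_iff_of_lt (h.length_eq_length hv hu) h1,
          perp_iff_of_lt (h.length_eq_length hu hw) h2, ← not_and_or]
        exact fun h3 => hbetween u hu h1 h2 h3.1 h3.2)
      rwa [Set.image_image] at this
    have hG := h.step c .newPerp hstep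
    have hDom : ∀ q ∈ Q, ∀ q' ∈ Q, Dom (prolong f Q c q) (prolong f Q c q') ↔
        Dom (f q) (f q') ∧ ¬ (f q = f v ∧ f q' = f w) := by
      intro q hq q' hq'
      rw [prolong_of_mem hq, prolong_of_mem hq', dom_snoc (h.length_eq_length hq hq')]
      exact and_congr_right fun hd => perpLetter_le_iff (h.length_eq_length hq hv)
        (h.length_eq_length hq' hv) hlt (hbetween q hq) hd
    have hPrec : ∀ q ∈ Q, ∀ q' ∈ Q, Prec (prolong f Q c q) (prolong f Q c q') ↔
        Prec (f q) (f q') := by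
      intro q hq q' hq'
      rw [prolong_of_mem hq, prolong_of_mem hq', prec_snoc (h.length_eq_length hq hq')]
      exact or_iff_left fun hL => perpLetter_ne_L _ _ _ hL.2.1
    have hord : ∀ q ∈ Q, ∀ q' ∈ Q, prolong f Q c q < prolong f Q c q' ↔ t q < t q' := by
      intro q hq q' hq'
      rw [prolong_of_mem hq, prolong_of_mem hq', snoc_lt_snoc (h.length_eq_length hq hq'),
        ← ht q hq q' hq']
      exact or_iff_left fun h1 => h1.2.ne (by simp only [hc, h1.1])
    obtain ⟨f', i', hp, hG', hrel⟩ := ih _ (ncard_relatedValues_lt hfin (by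
        rintro q hq q' hq' ⟨h1, h2⟩
        exact ⟨((hDom q hq q' hq').1 h1).1, h2⟩) hv hw ⟨hdom, hnD⟩ (by
        rintro q hq q' hq' h1 h2 ⟨h3, -⟩
        exact ((hDom q hq q' hq').1 h3).2
          ⟨(eq_iff_of_lt_iff ht hq hv).2 h1, (eq_iff_of_lt_iff ht hq' hw).2 h2⟩)) hG hord
      (fun q hq q' hq' hd => (hDom q hq q' hq').2 ⟨hD q hq q' hq' hd, fun he => hnD
        (htrans v hv q hq w hw (hrefl v hv q hq ((eq_iff_of_lt_iff ht hv hq).1 he.1.symm))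
          (htrans q hq q' hq' w hw hd (hrefl q' hq' w hw ((eq_iff_of_lt_iff ht hq' hw).1 he.2))))⟩)
      (fun q hq q' hq' hpr => hP q hq q' hq' ((hPrec q hq q' hq').1 hpr)) rfl
    exact ⟨f', i', (prolongs_prolong f Q i c).trans subset_rfl hp, hG', fun q hq q' hq' =>
      ⟨(hrel q hq q' hq').1, (hrel q hq q' hq').2.1,
        (hrel q hq q' hq').2.2.trans (hPrec q hq q' hq')⟩⟩
  · push Not at hbad
    exact ⟨f, i, Prolongs.refl f Q i, h, fun q hq q' hq' =>
      ⟨ht q hq q' hq', ⟨hbad q' hq' q hq, hD q hq q' hq'⟩, Iff.rfl⟩⟩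

/-- Among missing pairs take `v` least, then `w` greatest for this `v`. A smaller `u` dominated by
`v` satisfies `S u w` by `hDS`, so `u ≺ w` holds already by the choice of `v`; dually above `w`.
These are the side conditions of New `⪯`. -/
theorem Grown.exists_prec_iff [PartialOrder P] (hfin : (t '' Q).Finite) {i : ℕ} (h : Grown f Q i)
    (ht : ∀ q ∈ Q, ∀ q' ∈ Q, f q < f q' ↔ t q < t q') {S : P → P → Prop}
    (hP : ∀ q ∈ Q, ∀ q' ∈ Q, Prec (f q) (f q') → S q q')
    (hS : ∀ q ∈ Q, ∀ q' ∈ Q, S q q' → Dom (f q) (f q') ∧ t q ≠ t q')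
    (hDS : ∀ q ∈ Q, ∀ q' ∈ Q, ∀ r ∈ Q, Dom (f q) (f q') → S q' r → S q r)
    (hSD : ∀ q ∈ Q, ∀ q' ∈ Q, ∀ r ∈ Q, S q q' → Dom (f q') (f r) → S q r) :
    ∃ f' i', Prolongs f Q i f' i' ∧ Grown f' Q i' ∧ ∀ q ∈ Q, ∀ q' ∈ Q,
      (f' q < f' q' ↔ t q < t q') ∧ (Dom (f' q) (f' q') ↔ Dom (f q) (f q')) ∧
      (Prec (f' q) (f' q') ↔ S q q') := by
  induction hN : (relatedValues t Q fun q q' => S q q' ∧ ¬ Prec (f q) (f q')).ncard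
    using Nat.strong_induction_on generalizing f i with
  | _ N ih =>
  subst hN
  by_cases hbad : ∃ v ∈ Q, ∃ w ∈ Q, S v w ∧ ¬ Prec (f v) (f w)
  · obtain ⟨v, hv, hvw, hvmin⟩ := exists_isLeast_of_finite_image hfin hbad
    obtain ⟨w, hw, ⟨hvS, hnP⟩, hwmax⟩ :=
      exists_isLeast_of_finite_image (τ := τᵒᵈ) (t := t) hfin hvw
    obtain ⟨hdom, hne⟩ := hS v hv w hw hvS
    have hle := hdom.le (h.length_eq_length hv hw)
    have hlt : f v < f w := lt_of_le_of_ne hle fun he => hne ((eq_iff_of_lt_iff ht hv hw).1 he)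
    have hleft : ∀ u ∈ Q, f u < f v → Dom (f u) (f v) → Prec (f u) (f w) := by
      intro u hu h1 h2
      by_contra hn
      exact absurd (hvmin u hu ⟨w, hw, hDS u hu v hv w hw h2 hvS, hn⟩)
        (not_le.2 ((ht u hu v hv).1 h1))
    have hright : ∀ u ∈ Q, f w < f u → Dom (f w) (f u) → Prec (f v) (f u) := by
      intro u hu h1 h2
      by_contra hn
      have : t u ≤ t w := hwmax u hu ⟨hSD v hv w hw u hu hvS h2, hn⟩
      exact absurd this (not_le.2 ((ht w hw u hu).1 h1))
    have hnrel : ¬ Related (f v) (f w) := by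
      rintro ((h1 | h1) | (h1 | h1) | h1)
      · exact hnP h1
      · exact hlt.ne h1
      · exact (h1.lt (h.length_eq_length hw hv)).not_gt hlt
      · exact hlt.ne' h1
      · exact (perp_iff.1 h1).2 hdom
    set c : P → Letter := fun q => precLetter (f v) (f w) (f q) with hc
    have hstep : NewPrecStep (f '' Q) ((fun p => snoc (f p) (c p)) '' Q) := by
      have := newPrecStep_image (A := f '' Q) ⟨v, hv, rfl⟩ ⟨w, hw, rfl⟩ hlt hnrel (by
        rintro _ ⟨u, hu, rfl⟩ h1
        rw [perp_iff_of_lt (h.length_eq_length hu hv) h1, or_iff_not_imp_right, not_not]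
        exact fun h2 => Or.inl (hleft u hu h1 h2)) (by
        rintro _ ⟨u, hu, rfl⟩ h1
        rw [perp_iff_of_lt (h.length_eq_length hw hu) h1, or_iff_not_imp_right, not_not]
        exact fun h2 => Or.inl (hright u hu h1 h2))
      rwa [Set.image_image] at this
    have hG := h.step c .newPrec hstep
    have hDom : ∀ q ∈ Q, ∀ q' ∈ Q, Dom (prolong f Q c q) (prolong f Q c q') ↔
        Dom (f q) (f q') := by
      intro q hq q' hq'
      rw [prolong_of_mem hq, prolong_of_mem hq', dom_snoc (h.length_eq_length hq hq')]
      exact and_iff_left_of_imp (precLetter_mono (h.length_eq_length hq hv)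
        (h.length_eq_length hq' hv) (h.length_eq_length hw hv))
    have hPrec : ∀ q ∈ Q, ∀ q' ∈ Q, Prec (prolong f Q c q) (prolong f Q c q') ↔
        Prec (f q) (f q') ∨ f q = f v ∧ f q' = f w := by
      intro q hq q' hq'
      rw [prolong_of_mem hq, prolong_of_mem hq', prec_snoc (h.length_eq_length hq hq')]
      constructor
      · rintro (h1 | ⟨-, h1, h2⟩)
        · exact Or.inl h1
        · exact precLetter_eq (h.length_eq_length hq hv) (h.length_eq_length hq' hv)
            (h.length_eq_length hw hv) (hleft q hq) (hright q' hq') h1 h2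
      · rintro (h1 | ⟨h1, h2⟩)
        · exact Or.inl h1
        · refine Or.inr ⟨h1 ▸ h2 ▸ hdom, ?_, ?_⟩
          · simp only [hc, h1, precLetter_left]
          · simp only [hc, h2, precLetter_right hlt]
    have hord : ∀ q ∈ Q, ∀ q' ∈ Q, prolong f Q c q < prolong f Q c q' ↔ t q < t q' := by
      intro q hq q' hq'
      rw [prolong_of_mem hq, prolong_of_mem hq', snoc_lt_snoc (h.length_eq_length hq hq'),
        ← ht q hq q' hq']
      exact or_iff_left fun h1 => h1.2.ne (by simp only [hc, h1.1])
    obtain ⟨f', i', hp, hG', hrel⟩ := ih _ (ncard_relatedValues_lt hfin (by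
        rintro q hq q' hq' ⟨h1, h2⟩
        exact ⟨h1, fun h3 => h2 ((hPrec q hq q' hq').2 (Or.inl h3))⟩) hv hw ⟨hvS, hnP⟩ (by
        rintro q hq q' hq' h1 h2 ⟨-, h3⟩
        exact h3 ((hPrec q hq q' hq').2 (Or.inr
          ⟨(eq_iff_of_lt_iff ht hq hv).2 h1, (eq_iff_of_lt_iff ht hq' hw).2 h2⟩)))) hG hord
      (by
        intro q hq q' hq' hpr
        rcases (hPrec q hq q' hq').1 hpr with h1 | ⟨h1, h2⟩
        · exact hP q hq q' hq' h1
        -- Equal words dominate each other, so `hDS` and `hSD` make `S` depend on the words only.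
        · refine hDS q hq v hv q' hq' (h1 ▸ Dom.refl _) ?_
          exact hSD v hv w hw q' hq' hvS (h2 ▸ Dom.refl _))
      (fun q hq q' hq' hs => ⟨(hDom q hq q' hq').2 (hS q hq q' hq' hs).1, (hS q hq q' hq' hs).2⟩)
      (fun q hq q' hq' r hr hd hs => hDS q hq q' hq' r hr ((hDom q hq q' hq').1 hd) hs)
      (fun q hq q' hq' r hr hs hd => hSD q hq q' hq' r hr hs ((hDom q' hq' r hr).1 hd)) rfl
    exact ⟨f', i', (prolongs_prolong f Q i c).trans subset_rfl hp, hG', fun q hq q' hq' =>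
      ⟨(hrel q hq q' hq').1, (hrel q hq q' hq').2.1.trans (hDom q hq q' hq'),
        (hrel q hq q' hq').2.2⟩⟩
  · push Not at hbad
    exact ⟨f, i, Prolongs.refl f Q i, h, fun q hq q' hq' =>
      ⟨ht q hq q' hq', Iff.rfl, ⟨hP q hq q' hq', hbad q hq q' hq'⟩⟩⟩

end

/-! ### Levels of the closure, and types over the elements already placed -/

theorem closure_closure (S : Set Word) : closure (closure S) = closure S := by
  ext u
  constructor
  · rintro ⟨_, ⟨w, hw, i, hi, rfl⟩, j, hj, rfl⟩
    exact ⟨w, hw, min j i, (min_le_right _ _).trans hi, List.take_take⟩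
  · exact fun hu => ⟨u, hu, u.length, le_rfl, List.take_length.symm⟩

section

variable {P : Type*}

theorem level_closure_range (f : P → Word) (j : ℕ) :
    level (closure (Set.range f)) j = segments f j := by
  ext u
  constructor
  · rintro ⟨⟨_, ⟨p, rfl⟩, i, hi, rfl⟩, hl⟩
    rw [List.length_take, min_eq_left hi] at hl
    subst hl
    exact ⟨p, hi, rfl⟩
  · rintro ⟨p, hp, rfl⟩
    exact ⟨⟨f p, ⟨p, rfl⟩, j, hp, rfl⟩, by rw [List.length_take, min_eq_left hp]⟩

variable [PartialOrder P]

/-- The order of the types of elements over `F`: enlarging an element enlarges its type. -/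
def TypeLE (F : Set P) (q q' : P) : Prop :=
  (∀ r ∈ F, r ≤ q → r ≤ q') ∧ ∀ r ∈ F, q' ≤ r → q ≤ r

/-- The elements `q < q'` are separated by an element of `F`. -/
def Separated (F : Set P) (q q' : P) : Prop := q < q' ∧ ∃ r ∈ F, q ≤ r ∧ r ≤ q'

theorem TypeLE.trans {F : Set P} {a b c : P} (h : TypeLE F a b) (h' : TypeLE F b c) :
    TypeLE F a c :=
  ⟨fun r hr hra => h'.1 r hr (h.1 r hr hra), fun r hr hcr => h.2 r hr (h'.2 r hr hcr)⟩

theorem typeLE_of_le (F : Set P) {a b : P} (h : a ≤ b) : TypeLE F a b :=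
  ⟨fun _ _ hra => hra.trans h, fun _ _ hbr => h.trans hbr⟩

theorem typeLE_insert_iff {F : Set P} {p a b : P} :
    TypeLE (insert p F) a b ↔ TypeLE F a b ∧ (p ≤ a → p ≤ b) ∧ (b ≤ p → a ≤ p) := by
  simp only [TypeLE, Set.forall_mem_insert]
  tauto

theorem Separated.mono {F G : Set P} (hFG : F ⊆ G) {a b : P} (h : Separated F a b) :
    Separated G a b :=
  ⟨h.1, h.2.imp fun _ hr => ⟨hFG hr.1, hr.2⟩⟩

theorem Separated.not_typeLE {F : Set P} {a b : P} (h : Separated F a b) : ¬ TypeLE F b a := by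
  obtain ⟨hab, r, hr, har, hrb⟩ := h
  exact fun h => hab.not_ge ((h.2 r hr har).trans (h.1 r hr hrb))

/-- The separating element lies in `F`, so types see it. This and the dual provide `hDS` and `hSD`
in `Grown.exists_prec_iff`. -/
theorem TypeLE.trans_separated {F : Set P} {a b c : P} (h : TypeLE F a b)
    (h' : Separated F b c) : Separated F a c := by
  obtain ⟨hbc, r, hr, hbr, hrc⟩ := h'
  refine ⟨lt_of_le_of_ne ((h.2 r hr hbr).trans hrc) ?_, r, hr, h.2 r hr hbr, hrc⟩
  rintro rfl
  exact hbc.not_ge ((h.2 r hr hbr).trans (h.1 r hr hrc))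

theorem Separated.trans_typeLE {F : Set P} {a b c : P} (h : Separated F a b)
    (h' : TypeLE F b c) : Separated F a c := by
  obtain ⟨hab, r, hr, har, hrb⟩ := h
  refine ⟨lt_of_le_of_ne (har.trans (h'.1 r hr hrb)) ?_, r, hr, har, h'.1 r hr hrb⟩
  rintro rfl
  exact hab.not_ge ((h'.2 r hr har).trans (h'.1 r hr hrb))

open Classical in
/-- The position of the type of `q` over `p` in a linear extension of the order of types. -/
noncomputable def typeRank (p q : P) : ℕ :=
  if q < p then 0 else if q = p then 1 else if p < q then 3 else 2

theorem typeRank_le (p q : P) : typeRank p q ≤ 3 := by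
  unfold typeRank
  split_ifs <;> omega

theorem le_iff_typeRank (p q : P) : p ≤ q ↔ typeRank p q = 1 ∨ typeRank p q = 3 := by
  unfold typeRank
  split_ifs with h1 h2 h3
  · simpa using h1.not_ge
  · simp [h2]
  · simpa using h3.le
  · simpa using fun h => (h.eq_or_lt).elim (fun h' => h2 h'.symm) h3

theorem ge_iff_typeRank (p q : P) : q ≤ p ↔ typeRank p q = 0 ∨ typeRank p q = 1 := by
  unfold typeRank
  split_ifs with h1 h2 h3
  · simpa using h1.le
  · simp [h2]
  · simpa using h3.not_ge
  · simpa using fun h => (h.eq_or_lt).elim h2 h1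

/-- Being below `p` is the least type and being above `p` the greatest. Equality and incomparability
are incomparable types, so the order of ranks `1` and `2` is an arbitrary choice. -/
theorem typeRank_mono {p a b : P} (h : p ≤ a → p ≤ b) (h' : b ≤ p → a ≤ p) :
    typeRank p a ≤ typeRank p b := by
  rw [le_iff_typeRank, le_iff_typeRank] at h
  rw [ge_iff_typeRank, ge_iff_typeRank] at h'
  have := typeRank_le p a
  have := typeRank_le p b
  omega

/-- The relations between the words of elements of `Q` are those between their types over `F`. -/
def Matches (f : P → Word) (Q F : Set P) : Prop :=
  ∀ q ∈ Q, ∀ q' ∈ Q, (Dom (f q) (f q') ↔ TypeLE F q q') ∧ (Prec (f q) (f q') ↔ Separated F q q')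

/-! ### One stage of the construction -/

variable {f : P → Word} {Q F : Set P} {i : ℕ}

/-- By `hm`, words correspond to types over `F`, so a word together with a rank encodes a type over
`insert p F`. Dominance is corrected before `≺`, since `Separated` is compatible with the dominance
of the new types. -/
theorem Grown.exists_matches_insert (h : Grown f Q i) (hm : Matches f Q F) (p : P) :
    ∃ f' i', Prolongs f Q i f' i' ∧ Grown f' Q i' ∧ Matches f' Q (insert p F) := by
  set t : P → Word ×ₗ ℕ := fun q => toLex (f q, typeRank p q) with ht
  have hfin : (t '' Q).Finite := by
    refine (((List.finite_length_eq Letter i).prod (Set.finite_Iic 3)).image toLex).subset ?_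
    rintro _ ⟨q, hq, rfl⟩
    exact ⟨(f q, typeRank p q), ⟨h.length_eq q hq, typeRank_le p q⟩, rfl⟩
  obtain ⟨f₁, i₁, hp₁, h₁, hf₁⟩ := h.exists_refine (t := t) hfin
    (fun q hq q' hq' hlt => Prod.Lex.toLex_lt_toLex.2 (Or.inl hlt))
  obtain ⟨f₂, i₂, hp₂, h₂, hf₂⟩ := h₁.exists_dom_iff (t := t) hfin
    (fun q hq q' hq' => (hf₁ q hq q' hq').1) (D := TypeLE (insert p F))
    (by
      intro q hq q' hq' he
      obtain ⟨h1, h2⟩ := Prod.mk.inj (toLex.injective he)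
      rw [typeLE_insert_iff, ← (hm q hq q' hq').1, le_iff_typeRank, le_iff_typeRank p q',
        ge_iff_typeRank, ge_iff_typeRank, h1, h2]
      exact ⟨Dom.refl _, id, id⟩)
    (fun q _ q' _ r _ => TypeLE.trans)
    (by
      intro q hq q' hq' hD
      obtain ⟨h1, h2, h3⟩ := typeLE_insert_iff.1 hD
      have hd := (hm q hq q' hq').1.2 h1
      refine (hf₁ q hq q' hq').2.1.2 ⟨Prod.Lex.toLex_le_toLex.2 ?_, hd⟩
      exact (hd.le (h.length_eq_length hq hq')).lt_or_eq.imp id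
        fun he => ⟨he, typeRank_mono h2 h3⟩)
    (fun q hq q' hq' hP =>
      typeLE_of_le _ ((hm q hq q' hq').2.1 ((hf₁ q hq q' hq').2.2.1 hP)).1.le)
  obtain ⟨f₃, i₃, hp₃, h₃, hf₃⟩ := h₂.exists_prec_iff (t := t) hfin
    (fun q hq q' hq' => (hf₂ q hq q' hq').1) (S := Separated (insert p F))
    (fun q hq q' hq' hP => ((hm q hq q' hq').2.1 ((hf₁ q hq q' hq').2.2.1
      ((hf₂ q hq q' hq').2.2.1 hP))).mono (Set.subset_insert _ _))
    (by
      intro q hq q' hq' hS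
      refine ⟨(hf₂ q hq q' hq').2.1.2 (typeLE_of_le _ hS.1.le), fun he => hS.not_typeLE ?_⟩
      rw [← (hf₂ q' hq' q hq).2.1,
        (eq_iff_of_lt_iff (fun q hq q' hq' => (hf₂ q hq q' hq').1) hq hq').2 he]
      exact Dom.refl _)
    (fun q hq q' hq' r hr hd hs => ((hf₂ q hq q' hq').2.1.1 hd).trans_separated hs)
    (fun q hq q' hq' r hr hs hd => hs.trans_typeLE ((hf₂ q' hq' r hr).2.1.1 hd))
  exact ⟨f₃, i₃, (hp₁.trans subset_rfl hp₂).trans subset_rfl hp₃, h₃, fun q hq q' hq' =>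
    ⟨(hf₃ q hq q' hq').2.1.trans (hf₂ q hq q' hq').2.1, (hf₃ q hq q' hq').2.2⟩⟩

/-- With `p` in `F`, the element `p` itself separates it from everything comparable to it, and an
element incomparable to `p` fails dominance both ways. Also no other element has the type of `p`, so
its word is not shared. -/
theorem Grown.exists_remove (h : Grown f Q i) {p : P} (hp : p ∈ Q) (hpF : p ∈ F)
    (hm : Matches f Q F) :
    ∃ f', Prolongs f Q i f' (i + 1) ∧ Grown f' (Q \ {p}) (i + 1) ∧ Matches f' (Q \ {p}) F := by
  have hne : ∀ q ∈ Q, q ≠ p → f q ≠ f p := by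
    intro q hq hqp he
    have h1 := (hm q hq p hp).1.1 (he ▸ Dom.refl _)
    have h2 := (hm p hp q hq).1.1 (he ▸ Dom.refl _)
    exact hqp (le_antisymm (h1.2 p hpF le_rfl) (h2.1 p hpF le_rfl))
  have hprec : ∀ q ∈ Q, (Prec (f p) (f q) ↔ p < q) ∧ (Prec (f q) (f p) ↔ q < p) := fun q hq =>
    ⟨(hm p hp q hq).2.trans ⟨fun hs => hs.1, fun hlt => ⟨hlt, p, hpF, le_rfl, hlt.le⟩⟩,
      (hm q hq p hp).2.trans ⟨fun hs => hs.1, fun hlt => ⟨hlt, p, hpF, hlt.le, le_rfl⟩⟩⟩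
  have hstep : LeafStep (f '' Q) ((fun q => snoc (f q) X) '' (Q \ {p})) := by
    refine ⟨f p, ⟨p, hp, rfl⟩, ?_, ?_⟩
    · rintro _ ⟨⟨q, hq, rfl⟩, hqp⟩
      by_cases h1 : p < q
      · exact Or.inl (Or.inl ((hprec q hq).1.2 h1))
      by_cases h2 : q < p
      · exact Or.inr (Or.inl (Or.inl ((hprec q hq).2.2 h2)))
      have hqp' : q ≠ p := fun he => hqp (by rw [he]; rfl)
      refine Or.inr (Or.inr (perp_iff.2 ⟨fun hd => ?_, fun hd => ?_⟩))
      · exact h2 (lt_of_le_of_ne (((hm q hq p hp).1.1 hd).2 p hpF le_rfl) hqp')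
      · exact h1 (lt_of_le_of_ne (((hm p hp q hq).1.1 hd).1 p hpF le_rfl) hqp'.symm)
    · ext x
      constructor
      · rintro ⟨q, ⟨hq, hqp⟩, rfl⟩
        exact ⟨f q, ⟨⟨q, hq, rfl⟩, hne q hq hqp⟩, rfl⟩
      · rintro ⟨_, ⟨⟨q, hq, rfl⟩, hqp⟩, rfl⟩
        exact ⟨q, ⟨hq, fun he => hqp (by rw [Set.mem_singleton_iff.1 he]; rfl)⟩, rfl⟩
  have hdead : ∀ q ∈ Q, q ∉ Q \ {p} → q = p := fun q hq hq' => by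
    by_contra hqp
    exact hq' ⟨hq, hqp⟩
  refine ⟨TernaryWords.prolong f (Q \ {p}) fun _ => X, ?_, h.step_subset Set.sdiff_subset _ .leaf
    hstep ?_ ?_, ?_⟩
  · have := prolongs_prolong f (Q \ {p}) i fun _ => X
    exact ⟨this.le, this.prefix_apply, fun q hq => this.apply_eq q fun hq' => hq hq'.1⟩
  · intro q hq hq' r hr he
    rw [hdead q hq hq'] at he ⊢
    by_contra hrp
    exact hne r hr (Ne.symm hrp) he.symm
  · intro q hq hq' r hr _
    rw [hdead q hq hq']
    exact hprec r hr
  · intro q hq q' hq'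
    have hl := h.length_eq_length hq.1 hq'.1
    rw [prolong_of_mem hq, prolong_of_mem hq', dom_snoc hl, prec_snoc hl,
      ← (hm q hq.1 q' hq'.1).1, ← (hm q hq.1 q' hq'.1).2]
    simp

/-! ### The enumeration and the limit -/

theorem exists_grown_seq (e : P ≃ ℕ) :
    ∃ (f : ℕ → P → Word) (l : ℕ → ℕ), ∀ n, Grown (f n) {q | n ≤ e q} (l n) ∧
      Prolongs (f n) {q | n ≤ e q} (l n) (f (n + 1)) (l (n + 1)) ∧ n ≤ l n := by
  let State (n : ℕ) := {x : (P → Word) × ℕ //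
    Grown x.1 {q | n ≤ e q} x.2 ∧ Matches x.1 {q | n ≤ e q} {q | e q < n}}
  have next : ∀ n (s : State n), ∃ s' : State (n + 1),
      Prolongs s.1.1 {q | n ≤ e q} s.1.2 s'.1.1 s'.1.2 ∧ s.1.2 < s'.1.2 := by
    rintro n ⟨⟨f, i⟩, hG, hM⟩
    obtain ⟨f₁, i₁, hp₁, hG₁, hM₁⟩ := hG.exists_matches_insert hM (e.symm n)
    obtain ⟨f₂, hp₂, hG₂, hM₂⟩ :=
      hG₁.exists_remove (p := e.symm n) (by simp) (Set.mem_insert _ _) hM₁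
    have hQ : {q | n ≤ e q} \ {e.symm n} = {q | n + 1 ≤ e q} := by
      ext q
      simp only [Set.mem_sdiff, Set.mem_ofPred_eq, Set.mem_singleton_iff, Equiv.eq_symm_apply]
      omega
    have hF : insert (e.symm n) {q | e q < n} = {q | e q < n + 1} := by
      ext q
      simp only [Set.mem_insert_iff, Set.mem_ofPred_eq, Equiv.eq_symm_apply]
      omega
    rw [hQ] at hG₂ hM₂
    rw [hF] at hM₂
    exact ⟨⟨⟨f₂, i₁ + 1⟩, hG₂, hM₂⟩, hp₁.trans subset_rfl hp₂, Nat.lt_succ_of_le hp₁.le⟩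
  choose step hstep using next
  -- Over the empty set there is a single type and nothing is separated, which fits empty words.
  have init : Grown (fun _ : P => ([] : Word)) {q | 0 ≤ e q} 0 ∧
      Matches (fun _ : P => ([] : Word)) {q | 0 ≤ e q} {q | e q < 0} := by
    refine ⟨⟨by simp, by simp, by simp, by simp, by simp⟩, fun q _ q' _ => ⟨?_, ?_⟩⟩
    · simp [Dom, TypeLE]
    · simp [Prec, Separated]
  let s : ∀ n, State n := fun n => Nat.rec ⟨⟨fun _ => [], 0⟩, init⟩ step n
  refine ⟨fun n => (s n).1.1, fun n => (s n).1.2, fun n =>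
    ⟨(s n).2.1, (hstep n (s n)).1, ?_⟩⟩
  induction n with
  | zero => exact Nat.zero_le _
  | succ n ih => exact Nat.succ_le_of_lt (ih.trans_lt (hstep n (s n)).2)

theorem exists_leaf_embedding (e : P ≃ ℕ) :
    ∃ ψ : P → Word, (∀ p q, ψ p <+: ψ q → p = q) ∧
      (∀ p q, q ≠ p → (Prec (ψ p) (ψ q) ↔ p < q)) ∧
      ∀ j, ∃ k : LevelKind, k.Holds (segments ψ j) (segments ψ (j + 1)) := by
  obtain ⟨f, l, h⟩ := exists_grown_seq e
  have hprol : ∀ n m, n ≤ m → Prolongs (f n) {q | n ≤ e q} (l n) (f m) (l m) := by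
    intro n m hnm
    induction m, hnm using Nat.le_induction with
    | base => exact Prolongs.refl _ _ _
    | succ m hnm ih => exact ih.trans (fun q hq => hnm.trans hq) (h m).2.1
  -- Stage `e p` turns `p` into a leaf, so its word is final from index `e p + 1` on.
  set ψ : P → Word := fun p => f (e p + 1) p with hψ
  have hfψ : ∀ n p, e p < n → f n p = ψ p := fun n p hp =>
    (hprol (e p + 1) n hp).apply_eq p (by simp)
  have hψprol : ∀ n, Prolongs (f n) {q | n ≤ e q} (l n) ψ (l n) := by
    refine fun n => ⟨le_rfl, fun p => ?_, fun p hp => (hfψ n p (not_le.1 hp)).symm⟩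
    rcases le_or_gt n (e p) with hp | hp
    · exact (hprol n (e p + 1) (by omega)).prefix_apply p
    · rw [hfψ n p hp]
  refine ⟨ψ, fun p q hpq => ?_, fun p q hqp => ?_, fun j => ?_⟩
  -- At this index both words are final.
  · have hp : e p < max (e p) (e q) + 1 := by omega
    rw [← hfψ _ p hp, ← hfψ (max (e p) (e q) + 1) q (by omega)] at hpq
    exact (h _).1.leaf p (not_le.2 hp) q hpq
  · have hp : e p < max (e p) (e q) + 1 := by omega
    rw [← hfψ _ p hp, ← hfψ (max (e p) (e q) + 1) q (by omega)]
    exact ((h _).1.prec p (not_le.2 hp) q hqp).1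
  · have hl := (h (j + 1)).2.2
    rw [(hψprol (j + 1)).segments_eq (h (j + 1)).1.length_eq hl,
      (hψprol (j + 1)).segments_eq (h (j + 1)).1.length_eq (j.le_succ.trans hl)]
    exact (h (j + 1)).1.holds j hl

end

end TernaryWords

theorem theorem3 {P : Type*} [PartialOrder P] (hP : IsGenericPartialOrder P) :
    ∃ ψ : (fun a b : P => a ≤ b) ↪r TernaryWords.PrecEq,
      TernaryWords.IsPosetType (TernaryWords.closure (Set.range ψ)) ∧
      ∀ p : P, TernaryWords.IsLeaf (TernaryWords.closure (Set.range ψ)) (ψ p) := by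
  -- An embedded copy of `ℕ` makes `P` infinite, so that all of `ℕ` enumerates it.
  obtain ⟨g⟩ := hP.universal ℕ
  have := hP.countable
  have : Infinite P := Infinite.of_injective g g.injective
  obtain ⟨_⟩ := nonempty_denumerable P
  obtain ⟨ψ, hleaf, hprec, hlevel⟩ := TernaryWords.exists_leaf_embedding (Denumerable.eqv P)
  have hinj : Function.Injective ψ := fun p q he => hleaf p q (he ▸ List.prefix_refl _)
  refine ⟨⟨⟨ψ, hinj⟩, @fun p q => ?_⟩, ⟨(TernaryWords.closure_closure _).symm, fun i _ => ?_⟩,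
    fun p => ⟨⟨ψ p, ⟨p, rfl⟩, (ψ p).length, le_rfl, List.take_length.symm⟩, ?_⟩⟩
  · change TernaryWords.Prec (ψ p) (ψ q) ∨ ψ p = ψ q ↔ p ≤ q
    rcases eq_or_ne q p with rfl | hqp
    · simp
    · rw [hprec p q hqp, hinj.eq_iff, le_iff_lt_or_eq]
  · change ∃! k : TernaryWords.LevelKind, k.Holds
      (TernaryWords.level (TernaryWords.closure (Set.range ψ)) i)
      (TernaryWords.level (TernaryWords.closure (Set.range ψ)) (i + 1))
    rw [TernaryWords.level_closure_range, TernaryWords.level_closure_range]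
    obtain ⟨k, hk⟩ := hlevel i
    exact ⟨k, hk, fun l hl => TernaryWords.LevelKind.holds_unique hl hk⟩
  · rintro _ ⟨_, ⟨q, rfl⟩, i, hi, rfl⟩ hpre
    change ψ p <+: (ψ q).take i at hpre
    change (ψ q).take i = ψ p
    obtain rfl := hleaf p q (hpre.trans (List.take_prefix _ _))
    exact (hpre.eq_of_length_le (by rw [List.length_take]; exact min_le_right _ _)).symm
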